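/- Let $M_2\subseteq\mathbb{Z}$ and let $\mathbb{V}(\mathbb{Z},M_2)$ be the strip $\{(x,y)\in\mathbb{R}^2 : 0\le y\le 1\}$ with marked points $(i,0)$, $i\in\mathbb{Z}$, and $(u,1)$, $u\in M_2$. An arc is a non-contractible curve in the strip joining two marked points, considered up to isotopy fixing its endpoints; boundary segments joining two consecutive marked points of the same boundary line are not arcs. An arc is peripheral if its endpoints lie on the same boundary line. Two arcs are compatible if they have representatives which do not meet except possibly at common endpoints. Let $T$ be a triangulation of $\mathbb{V}(\mathbb{Z},M_2)$, that is, a maximal collection of pairwise compatible arcs. Assume that $T$ is admissible, that is, every marked point $(i,0)$ is incident with only finitely many arcs of $T$, and that every marked point $(u,1)$ with $u\in M_2$ is incident with at least one arc of $T$. An infinite frieze is a map $t:\mathbb{Z}\times\mathbb{Z}\to\mathbb{Z}$ such that, for all $i,j\in\mathbb{Z}$: $t(i,i)=0$; $t(i,j)\ge 1$ if $i<j$; $t(i,i+1)=1$; $t(i,j)=-t(j,i)$; and $t(i,j)\,t(i+1,j+1)-t(i,j+1)\,t(i+1,j)=1$. Then each $(i,0)$ is incident with finitely many triangles of $T$ (their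 sides being arcs of $T$ or boundary segments), and there is a unique infinite frieze $t=\Phi(T)$ such that, for every $i\in\mathbb{Z}$, $t(i-1,i+1)$ is the number of triangles of $T$ incident with $(i,0)$. Moreover, for all $i,j\in\mathbb{Z}$ with $i\le j$, $t(i,j)=1$ if and only if $j=i+1$ or $T$ contains a peripheral arc from $(i,0)$ to $(j,0)$. -/

import Mathlib

open Set

namespace InfiniteStrip

/-- The infinite strip of height one in the plane, boundary lines included. -/
abbrev Strip : Type := {p : ℝ × ℝ // 0 ≤ p.2 ∧ p.2 ≤ 1}

/-- The marked points of the strip `𝕍(ℤ, M₂)`: one point `lower i` for each integer `i`, and one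
point `upper u` for each `u ∈ M₂`. -/
inductive MarkedPoint (M₂ : Set ℤ) : Type
  | lower (i : ℤ) : MarkedPoint M₂
  | upper (u : M₂) : MarkedPoint M₂

/-- The position of a marked point: `lower i` is `(i, 0)` and `upper u` is `(u, 1)`. -/
def MarkedPoint.pos {M₂ : Set ℤ} : MarkedPoint M₂ → Strip
  | .lower i => ⟨((i : ℝ), 0), le_refl (0 : ℝ), zero_le_one⟩
  | .upper u => ⟨(((u : ℤ) : ℝ), 1), zero_le_one, le_refl (1 : ℝ)⟩

/-- A simple curve in the strip whose relative interior lies in the open strip. -/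
def IsSimpleCurve {p q : Strip} (γ : Path p q) : Prop :=
  Function.Injective γ ∧
    ∀ s : unitInterval, s ≠ 0 → s ≠ 1 → 0 < (γ s : ℝ × ℝ).2 ∧ (γ s : ℝ × ℝ).2 < 1

/-- Two curves with the same endpoints in the strip are always homotopic relative to their
endpoints: the class of a curve in the strip is determined by its two endpoints. -/
theorem curves_homotopic {p q : Strip} (γ δ : Path p q) : γ.Homotopic δ := by
  have hc : Convex ℝ {x : ℝ × ℝ | 0 ≤ x.2 ∧ x.2 ≤ 1} := by
    intro x hx y hy a b ha hb hab
    simp only [mem_ofPred_eq, Prod.snd_add, Prod.smul_snd, smul_eq_mul] at *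
    constructor <;> nlinarith [mul_nonneg ha hx.1, mul_nonneg hb hy.1,
      mul_nonneg ha (sub_nonneg.2 hx.2), mul_nonneg hb (sub_nonneg.2 hy.2)]
  have : ContractibleSpace Strip :=
    hc.contractibleSpace ⟨((0 : ℝ), (0 : ℝ)), le_refl (0 : ℝ), zero_le_one⟩
  exact SimplyConnectedSpace.paths_homotopic γ δ

/-- `P` and `Q` are consecutive marked points of the same boundary line (no marked point lies
strictly between them): they are joined by a boundary segment. -/
def IsBoundarySegment {M₂ : Set ℤ} : MarkedPoint M₂ → MarkedPoint M₂ → Prop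
  | .lower i, .lower j => i ⋖ j ∨ j ⋖ i
  | .upper u, .upper v => u ⋖ v ∨ v ⋖ u
  | _, _ => False

/-- Arcs are considered up to isotopy fixing the endpoints and without orientation, so an arc is
recorded by the unordered pair of its endpoints. A pair of marked points is an arc when the curves
joining them are non-contractible: the two points are distinct, and they do not cut out a boundary
segment. -/
def IsArc {M₂ : Set ℤ} (e : Sym2 (MarkedPoint M₂)) : Prop :=
  ∃ P Q : MarkedPoint M₂, e = s(P, Q) ∧ P ≠ Q ∧ ¬ IsBoundarySegment P Q

/-- Two arcs are compatible if they have representatives (simple curves in the strip) that do not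
meet, except maybe at common endpoints. -/
def Compatible {M₂ : Set ℤ} (e f : Sym2 (MarkedPoint M₂)) : Prop :=
  ∃ (P Q R S : MarkedPoint M₂) (γ : Path P.pos Q.pos) (δ : Path R.pos S.pos),
    e = s(P, Q) ∧ f = s(R, S) ∧ IsSimpleCurve γ ∧ IsSimpleCurve δ ∧
      ∀ s t : unitInterval, γ s = δ t → (s = 0 ∨ s = 1) ∧ (t = 0 ∨ t = 1)

/-- A triangulation is a maximal collection of pairwise compatible arcs. -/
def IsTriangulation {M₂ : Set ℤ} (T : Set (Sym2 (MarkedPoint M₂))) : Prop :=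
  Maximal (fun S : Set (Sym2 (MarkedPoint M₂)) => (∀ e ∈ S, IsArc e) ∧ S.Pairwise Compatible) T

/-- Every lower marked point is incident with only finitely many arcs. -/
def IsAdmissible {M₂ : Set ℤ} (T : Set (Sym2 (MarkedPoint M₂))) : Prop :=
  ∀ i : ℤ, {e ∈ T | MarkedPoint.lower i ∈ e}.Finite

/-- A marked point is special if it is incident with no arc of `T`. -/
def IsSpecial {M₂ : Set ℤ} (T : Set (Sym2 (MarkedPoint M₂))) (P : MarkedPoint M₂) : Prop :=
  ∀ e ∈ T, P ∉ e

/-- The graph on the marked points whose edges are the arcs of `T` and the boundary segments. -/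
def sideGraph {M₂ : Set ℤ} (T : Set (Sym2 (MarkedPoint M₂))) : SimpleGraph (MarkedPoint M₂) where
  Adj P Q := P ≠ Q ∧ (IsBoundarySegment P Q ∨ s(P, Q) ∈ T)
  symm := ⟨by
    rintro P Q ⟨hne, h⟩
    refine ⟨hne.symm, h.imp (fun h => ?_) (fun h => Sym2.eq_swap ▸ h)⟩
    cases P <;> cases Q <;> simp only [IsBoundarySegment] at h ⊢ <;> tauto⟩
  loopless := ⟨fun _ h => h.1 rfl⟩

/-- The triangles of `T` incident with `P`: triples of marked points containing `P`, any two of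
which are joined by an arc of `T` or by a boundary segment. -/
def trianglesAt {M₂ : Set ℤ} (T : Set (Sym2 (MarkedPoint M₂))) (P : MarkedPoint M₂) :
    Set (Finset (MarkedPoint M₂)) :=
  {Δ | (sideGraph T).IsNClique 3 Δ ∧ P ∈ Δ}

/-- Infinite friezes, as fillings of the whole discrete plane. -/
structure IsInfiniteFrieze (t : ℤ → ℤ → ℤ) : Prop where
  diag : ∀ i, t i i = 0
  pos : ∀ i j, i < j → 1 ≤ t i j
  one : ∀ i, t i (i + 1) = 1
  antisymm : ∀ i j, t i j = -t j i
  unimodular : ∀ i j, t i j * t (i + 1) (j + 1) - t i (j + 1) * t (i + 1) j = 1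

/-- `t = Φ(T)`: `t` is the infinite frieze whose quiddity sequence `(t (i - 1) (i + 1))_i` is the
sequence of the numbers of triangles of `T` incident with the points `(i, 0)`. -/
def IsPhi {M₂ : Set ℤ} (T : Set (Sym2 (MarkedPoint M₂))) (t : ℤ → ℤ → ℤ) : Prop :=
  IsInfiniteFrieze t ∧ ∀ i : ℤ, (trianglesAt T (.lower i)).Finite ∧
    t (i - 1) (i + 1) = ((trianglesAt T (.lower i)).ncard : ℤ)

end InfiniteStrip

/-! The exponential `z ↦ exp (π z)` turns the strip into the closed upper half plane without `0`,
with the marked points on the real line. There, two distinct pairs of marked points are compatible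
exactly when they do not separate each other: separated pairs force an intersection by counting
arguments around a square (`exists_eq_of_separated`), and half circles serve as disjoint
representatives otherwise. From then on everything is combinatorics of the sign condition `Crosses`.

Maximality makes consecutive neighbours of a vertex adjacent, so the number `q k` of triangles at
`(k, 0)` is its number of neighbours minus one. The frieze is the determinant `x i * y j - y i * x
j` of two solutions of `f (k + 1) + f (k - 1) = q k * f k`; its row `i` is the solution `f` with `f
i = 0` and `f (i + 1) = 1`. Under an arc, the third vertex of a triangle carries the sum of the
values at the two ends of the arc, and this gives `f j = 1` when `i` and `j` are joined
(`recurrence_of_lowerAdj`). When they are not, `f` grows by at least one at each step of a path of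
longest arcs from `i` to `j`, which has at least two steps, so `f j ≥ 2` (`two_le_of_path`).
Positivity and the description of the entries equal to `1` follow together. -/

namespace InfiniteStrip

/-! ### Plane topology: curves in the closed upper half plane. -/

section HalfPlane

open Complex

/-- Along a curve in the closed upper half plane from one real number to another, any continuous
choice of the argument changes as the principal argument does. -/
theorem im_sub_im_of_exp_upper {L : ℝ → ℂ} (hL : Continuous L)
    (h : ∀ s, 0 ≤ (exp (L s)).im) :
    (L 1).im - (L 0).im = arg (exp (L 1)) - arg (exp (L 0)) := by
  have hs : ∀ s, -I * exp (L s) ∈ slitPlane := by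
    intro s
    rw [mem_slitPlane_iff]
    have hne := exp_ne_zero (L s)
    rcases (h s).lt_or_eq with h1 | h1
    · left; simpa using h1
    · right
      intro h2
      apply hne
      apply Complex.ext
      · simpa using h2
      · simpa using h1.symm
  -- Multiplication by `-I` carries the closed upper half plane minus `0` into the slit plane, so
  -- this branch is continuous, up to and including the negative real axis.
  let l : ℝ → ℂ := fun s => log (-I * exp (L s)) + (Real.pi / 2 : ℝ) * I
  have hl : Continuous l := by
    refine Continuous.add ?_ continuous_const
    exact Continuous.clog (by fun_prop) hs
  have hexp : ∀ s, exp (l s) = exp (L s) := by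
    intro s
    have hne : -I * exp (L s) ≠ 0 := slitPlane_ne_zero (hs s)
    simp only [l]
    rw [exp_add, exp_log hne]
    push_cast
    rw [exp_pi_div_two_mul_I]
    linear_combination (-exp (L s)) * I_mul_I
  have him : ∀ s, (l s).im = arg (exp (L s)) := by
    intro s
    have h1 : log (exp (l s)) = l s := by
      have h2 : (l s).im = arg (-I * exp (L s)) + Real.pi / 2 := by simp [l, log_im]
      have h3 : |arg (-I * exp (L s))| ≤ Real.pi / 2 := by
        rw [abs_arg_le_pi_div_two_iff]
        simpa using h s
      have h4 := abs_le.1 h3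
      have := Real.pi_pos
      apply log_exp <;> linarith
    rw [← hexp s, ← log_im, h1]
  -- Two lifts of one curve through the covering `exp` differ by a constant.
  have key : (fun s => l s + (L 0 - l 0)) = L := by
    refine isCoveringMap_exp.eq_of_comp_eq (by fun_prop) hL ?_ 0 (by simp)
    ext s
    simp only [Function.comp_apply]
    rw [exp_add, exp_sub, hexp, hexp, div_self (exp_ne_zero _), mul_one]
  have h1 := congrFun key 1
  rw [← him, ← him, ← h1, Complex.add_im, Complex.sub_im]
  ring

theorem im_sub_im_of_exp_lower {L : ℝ → ℂ} (hL : Continuous L)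
    (h : ∀ s, (exp (L s)).im ≤ 0) {a b : ℝ} (ha : exp (L 0) = a) (hb : exp (L 1) = b) :
    (L 1).im - (L 0).im = arg a - arg b := by
  have := im_sub_im_of_exp_upper (L := fun s => (starRingEnd ℂ) (L s)) (by fun_prop) (by
    intro s
    rw [exp_conj]
    simpa using h s)
  simp only [exp_conj, ha, hb, conj_ofReal, conj_im] at this
  linarith

/-- Two curves in the closed upper half plane joining two pairs of real numbers which separate
each other have a common point. -/
theorem exists_eq_of_separated {γ δ : ℝ → ℂ} (hγ : Continuous γ) (hδ : Continuous δ)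
    (hγ0 : ∀ s, 0 ≤ (γ s).im) (hδ0 : ∀ s, 0 ≤ (δ s).im) {a b c d : ℝ}
    (ha : γ 0 = a) (hb : γ 1 = b) (hc : δ 0 = c) (hd : δ 1 = d)
    (h : (a - c) * (a - d) * (b - c) * (b - d) < 0) : ∃ s t, γ s = δ t := by
  by_contra! hne
  -- If the curves never meet, this difference has no zero and thus a global logarithm `G`. On each
  -- side of the unit square one of the two points is real, so the difference stays in a closed half
  -- plane and its change of argument is known.
  let F : C(ℝ × ℝ, ℂ) := ⟨fun x => γ x.1 - δ x.2, by fun_prop⟩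
  have hF : ∀ x, F x ∈ ({0}ᶜ : Set ℂ) := fun x => sub_ne_zero.2 (hne _ _)
  obtain ⟨G, ⟨-, hG⟩, -⟩ := isCoveringMapOn_exp.existsUnique_continuousMap_lifts F
    (a₀ := (0, 0)) (e₀ := log (F (0, 0))) (exp_log (hF _)) hF
  have hG' : ∀ s t, exp (G (s, t)) = γ s - δ t := fun s t => congrFun hG (s, t)
  have e1 := im_sub_im_of_exp_upper (L := fun s => G (s, 0)) (by fun_prop)
    (by intro s; rw [hG', hc]; simpa using hγ0 s)
  have e2 := im_sub_im_of_exp_upper (L := fun s => G (s, 1)) (by fun_prop)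
    (by intro s; rw [hG', hd]; simpa using hγ0 s)
  have e3 := im_sub_im_of_exp_lower (L := fun s => G (0, s)) (a := a - c) (b := a - d)
    (by fun_prop) (by intro s; rw [hG', ha]; simpa using hδ0 s)
    (by rw [hG', ha, hc]; simp) (by rw [hG', ha, hd]; simp)
  have e4 := im_sub_im_of_exp_lower (L := fun s => G (1, s)) (a := b - c) (b := b - d)
    (by fun_prop) (by intro s; rw [hG', hb]; simpa using hδ0 s)
    (by rw [hG', hb, hc]; simp) (by rw [hG', hb, hd]; simp)
  simp only [hG', ha, hb, hc, hd, ← ofReal_sub] at e1 e2 e3 e4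
  -- The change of `G` between opposite corners is the same along both boundary paths. Since each
  -- argument is `0` or `π`, an even number of the four differences is negative, against the sign of
  -- their product.
  have key : arg ((a - c : ℝ) : ℂ) + arg ((b - d : ℝ) : ℂ)
      = arg ((a - d : ℝ) : ℂ) + arg ((b - c : ℝ) : ℂ) := by linarith
  have harg : ∀ x : ℝ, x ≠ 0 → (x < 0 ∧ arg (x : ℂ) = Real.pi) ∨ (0 < x ∧ arg (x : ℂ) = 0) := by
    intro x hx
    rcases lt_or_gt_of_ne hx with h1 | h1
    · exact Or.inl ⟨h1, arg_ofReal_of_neg h1⟩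
    · exact Or.inr ⟨h1, arg_ofReal_of_nonneg h1.le⟩
  have hpi := Real.pi_pos
  have n1 : a - c ≠ 0 := by rintro h0; simp [h0] at h
  have n2 : a - d ≠ 0 := by rintro h0; simp [h0] at h
  have n3 : b - c ≠ 0 := by rintro h0; simp [h0] at h
  have n4 : b - d ≠ 0 := by rintro h0; simp [h0] at h
  rw [show (a - c) * (a - d) * (b - c) * (b - d) = ((a - c) * (b - d)) * ((a - d) * (b - c)) by
    ring] at h
  rcases harg _ n1 with ⟨h1, g1⟩ | ⟨h1, g1⟩ <;> rcases harg _ n2 with ⟨h2, g2⟩ | ⟨h2, g2⟩ <;>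
    rcases harg _ n3 with ⟨h3, g3⟩ | ⟨h3, g3⟩ <;> rcases harg _ n4 with ⟨h4, g4⟩ | ⟨h4, g4⟩ <;>
    rw [g1, g2, g3, g4] at key <;> first
      | linarith
      | (linarith [mul_pos (mul_pos_of_neg_of_neg h1 h4) (mul_pos_of_neg_of_neg h2 h3)])
      | (linarith [mul_pos (mul_pos h1 h4) (mul_pos h2 h3)])
      | (linarith [mul_pos_of_neg_of_neg (mul_neg_of_neg_of_pos h1 h4)
          (mul_neg_of_neg_of_pos h2 h3)])
      | (linarith [mul_pos_of_neg_of_neg (mul_neg_of_pos_of_neg h1 h4)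
          (mul_neg_of_neg_of_pos h2 h3)])
      | (linarith [mul_pos_of_neg_of_neg (mul_neg_of_neg_of_pos h1 h4)
          (mul_neg_of_pos_of_neg h2 h3)])
      | (linarith [mul_pos_of_neg_of_neg (mul_neg_of_pos_of_neg h1 h4)
          (mul_neg_of_pos_of_neg h2 h3)])

/-- The conformal map `z ↦ exp (π z)` from the strip to the closed upper half plane. -/
noncomputable def toHalfPlane (p : Strip) : ℂ :=
  exp (⟨Real.pi * (p : ℝ × ℝ).1, Real.pi * (p : ℝ × ℝ).2⟩ : ℂ)

theorem continuous_toHalfPlane : Continuous toHalfPlane := by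
  have h : toHalfPlane = fun p : Strip => exp (((Real.pi * (p : ℝ × ℝ).1 : ℝ) : ℂ)
      + ((Real.pi * (p : ℝ × ℝ).2 : ℝ) : ℂ) * I) := by
    funext p
    rw [toHalfPlane, ← mk_eq_add_mul_I]
  rw [h]
  fun_prop

theorem toHalfPlane_im_nonneg (p : Strip) : 0 ≤ (toHalfPlane p).im := by
  rw [toHalfPlane, exp_im]
  have := Real.pi_pos
  refine mul_nonneg (Real.exp_pos _).le (Real.sin_nonneg_of_nonneg_of_le_pi ?_ ?_)
  · exact mul_nonneg this.le p.2.1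
  · exact mul_le_of_le_one_right this.le p.2.2

theorem toHalfPlane_injective : Function.Injective toHalfPlane := by
  intro p q h
  have hpi := Real.pi_pos
  have bd : ∀ r : Strip, -Real.pi < Real.pi * (r : ℝ × ℝ).2 ∧
      Real.pi * (r : ℝ × ℝ).2 ≤ Real.pi := fun r =>
    ⟨by nlinarith [mul_nonneg hpi.le r.2.1], mul_le_of_le_one_right hpi.le r.2.2⟩
  have := exp_inj_of_neg_pi_lt_of_le_pi (bd p).1 (bd p).2 (bd q).1 (bd q).2 h
  rw [Complex.ext_iff] at this
  simp only [mul_eq_mul_left_iff, hpi.ne', or_false] at this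
  exact Subtype.ext (Prod.ext this.1 this.2)

/-- A branch of the logarithm which is continuous on the closed upper half plane without `0`. -/
noncomputable def upperLog (w : ℂ) : ℂ := log (-I * w) + (Real.pi / 2 : ℝ) * I

theorem exp_upperLog {w : ℂ} (hw : w ≠ 0) : exp (upperLog w) = w := by
  rw [upperLog, exp_add, exp_log (by simpa using hw)]
  push_cast
  rw [exp_pi_div_two_mul_I]
  linear_combination (-w) * I_mul_I

theorem continuousAt_upperLog {w : ℂ} (hw : w ≠ 0) (h : 0 ≤ w.im) : ContinuousAt upperLog w := by
  refine ContinuousAt.add (ContinuousAt.clog (by fun_prop) ?_) continuousAt_const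
  rw [mem_slitPlane_iff]
  rcases h.lt_or_eq with h1 | h1
  · left; simpa using h1
  · right
    intro h2
    exact hw (Complex.ext (by simpa using h2) (by simpa using h1.symm))

theorem upperLog_im {w : ℂ} : (upperLog w).im = arg (-I * w) + Real.pi / 2 := by
  simp [upperLog, log_im]

theorem upperLog_im_mem {w : ℂ} (h : 0 ≤ w.im) :
    0 ≤ (upperLog w).im ∧ (upperLog w).im ≤ Real.pi := by
  have := abs_le.1 (abs_arg_le_pi_div_two_iff (z := -I * w) |>.2 (by simpa using h))
  rw [upperLog_im]
  constructor <;> linarith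

theorem upperLog_im_mem_of_pos {w : ℂ} (h : 0 < w.im) :
    0 < (upperLog w).im ∧ (upperLog w).im < Real.pi := by
  have := abs_lt.1 (abs_arg_lt_pi_div_two_iff (z := -I * w) |>.2 (by left; simpa using h))
  rw [upperLog_im]
  constructor <;> linarith

/-- The inverse of `toHalfPlane`. -/
noncomputable def ofHalfPlane (w : {w : ℂ // 0 ≤ w.im}) : Strip :=
  ⟨((upperLog w).re / Real.pi, (upperLog w).im / Real.pi),
    div_nonneg (upperLog_im_mem w.2).1 Real.pi_pos.le,
    (div_le_one Real.pi_pos).2 (upperLog_im_mem w.2).2⟩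

theorem toHalfPlane_ofHalfPlane {w : {w : ℂ // 0 ≤ w.im}} (hw : (w : ℂ) ≠ 0) :
    toHalfPlane (ofHalfPlane w) = w := by
  have := Real.pi_pos.ne'
  rw [toHalfPlane, ofHalfPlane]
  simp only [mul_div_cancel₀ _ this]
  exact exp_upperLog hw

/-- A parametrization of the half circle with end points `a` and `b`. -/
noncomputable def halfCircle (a b : ℝ) (s : unitInterval) : {w : ℂ // 0 ≤ w.im} :=
  ⟨⟨a + (b - a) * s, |b - a| * √(s * (1 - s))⟩, by positivity⟩

theorem continuous_halfCircle (a b : ℝ) : Continuous (halfCircle a b) := by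
  refine Continuous.subtype_mk ?_ _
  have : (fun s : unitInterval => (⟨a + (b - a) * s, |b - a| * √(s * (1 - s))⟩ : ℂ)) =
      fun s : unitInterval => ((a + (b - a) * s : ℝ) : ℂ)
        + ((|b - a| * √(s * (1 - s)) : ℝ) : ℂ) * I := by
    funext s
    rw [← mk_eq_add_mul_I]
  rw [this]
  fun_prop

theorem halfCircle_im_pos {a b : ℝ} (hab : a ≠ b) {s : unitInterval} (h0 : s ≠ 0) (h1 : s ≠ 1) :
    0 < (halfCircle a b s : ℂ).im := by
  have h0' : (0 : ℝ) < s := unitInterval.pos_iff_ne_zero.2 h0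
  have h1' : (0 : ℝ) < 1 - s := sub_pos.2 (unitInterval.lt_one_iff_ne_one.2 h1)
  have := abs_pos.2 (sub_ne_zero.2 hab.symm)
  simp only [halfCircle]
  positivity

theorem halfCircle_injective {a b : ℝ} (hab : a ≠ b) : Function.Injective (halfCircle a b) := by
  intro s t h
  have h1 := congrArg (fun w : {w : ℂ // 0 ≤ w.im} => (w : ℂ).re) h
  simp only [halfCircle, add_right_inj, mul_eq_mul_left_iff, sub_eq_zero, hab.symm, or_false] at h1
  exact Subtype.ext h1

theorem halfCircle_ne_zero {a b : ℝ} (hab : a ≠ b) (ha : a ≠ 0) (hb : b ≠ 0) (s : unitInterval) :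
    (halfCircle a b s : ℂ) ≠ 0 := by
  intro h
  by_cases h0 : s = 0
  · subst h0
    exact ha (by simpa [halfCircle] using congrArg re h)
  by_cases h1 : s = 1
  · subst h1
    exact hb (by simpa [halfCircle] using congrArg re h)
  · exact (halfCircle_im_pos hab h0 h1).ne' (by rw [h]; rfl)

/-- Half circles over pairs of points which do not separate each other meet at end points only. -/
theorem halfCircle_eq_imp {a b c d : ℝ} (hab : a ≠ b) (hcd : c ≠ d)
    (hne : ¬ (a = c ∧ b = d)) (hne' : ¬ (a = d ∧ b = c))
    (h : 0 ≤ (a - c) * (a - d) * (b - c) * (b - d)) {s t : unitInterval}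
    (hst : halfCircle a b s = halfCircle c d t) : (s = 0 ∨ s = 1) ∧ (t = 0 ∨ t = 1) := by
  have hre := congrArg (fun w : {w : ℂ // 0 ≤ w.im} => (w : ℂ).re) hst
  have him := congrArg (fun w : {w : ℂ // 0 ≤ w.im} => (w : ℂ).im ^ 2) hst
  have hnn : ∀ u : unitInterval, 0 ≤ (u : ℝ) * (1 - u) := fun u =>
    mul_nonneg u.2.1 (sub_nonneg.2 u.2.2)
  simp only [halfCircle, mul_pow, sq_abs, Real.sq_sqrt (hnn s), Real.sq_sqrt (hnn t)] at hre him
  have hend : ∀ u : unitInterval, (u : ℝ) * (1 - u) = 0 → u = 0 ∨ u = 1 := by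
    intro u hu
    rcases mul_eq_zero.1 hu with h0 | h0
    · exact Or.inl (Subtype.ext h0)
    · exact Or.inr (Subtype.ext (by change (u : ℝ) = 1; linarith))
  have hb2 : 0 < (b - a) ^ 2 := by
    have := sub_ne_zero.2 hab.symm
    positivity
  have hd2 : 0 < (d - c) ^ 2 := by
    have := sub_ne_zero.2 hcd.symm
    positivity
  rcases (hnn s).lt_or_eq with hpos | hz
  · exfalso
    -- `x` is the abscissa of the common point, and the squared height is both `(x - a) * (b - x)`
    -- and `(x - c) * (d - x)`. This makes the separation product minus a square times a positive
    -- number, so the centres coincide, and then so do the end points.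
    set x : ℝ := a + (b - a) * s with hx
    have e1 : (b - a) ^ 2 * (s * (1 - s)) = (x - a) * (b - x) := by rw [hx]; ring
    have e2 : (d - c) ^ 2 * (t * (1 - t)) = (x - c) * (d - x) := by rw [hre]; ring
    have e3 : (x - a) * (b - x) = (x - c) * (d - x) := by rw [← e1, ← e2, him]
    have e4 : 0 < (x - a) * (b - x) := by rw [← e1]; positivity
    have e5 : (a - c) * (a - d) * (b - c) * (b - d) =
        -((a + b - (c + d)) ^ 2 * ((x - a) * (b - x))) := by
      have f1 : (a - c) * (a - d) = (a + b - (c + d)) * (a - x) := by linear_combination e3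
      have f2 : (b - c) * (b - d) = (a + b - (c + d)) * (b - x) := by linear_combination e3
      calc _ = ((a - c) * (a - d)) * ((b - c) * (b - d)) := by ring
        _ = _ := by rw [f1, f2]; ring
    have e6 : a + b - (c + d) = 0 := by
      by_contra h0
      have : 0 < (a + b - (c + d)) ^ 2 * ((x - a) * (b - x)) := by positivity
      linarith
    have e7 : (a - c) * (a - d) = 0 := by linear_combination e3 + (a - x) * e6
    rcases mul_eq_zero.1 e7 with h0 | h0
    · exact hne ⟨by linarith, by linarith⟩
    · exact hne' ⟨by linarith, by linarith⟩
  · refine ⟨hend s hz.symm, hend t ?_⟩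
    rw [← hz, mul_zero] at him
    rcases mul_eq_zero.1 him.symm with h0 | h0
    · exact absurd h0 hd2.ne'
    · exact h0

end HalfPlane

/-! ### Compatibility of arcs as a sign condition on the boundary. -/

section Compatible

variable {M₂ : Set ℤ}

/-- The position of a marked point on the boundary of the half plane model of the strip. -/
noncomputable def MarkedPoint.coord : MarkedPoint M₂ → ℝ
  | .lower i => Real.exp (Real.pi * i)
  | .upper u => -Real.exp (Real.pi * ((u : ℤ) : ℝ))

theorem coord_lower_lt {i j : ℤ} :
    (MarkedPoint.lower i : MarkedPoint M₂).coord < (MarkedPoint.lower j : MarkedPoint M₂).coord ↔ i < j := by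
  simp [MarkedPoint.coord, Real.pi_pos]

theorem coord_lower_pos (i : ℤ) : 0 < (MarkedPoint.lower i : MarkedPoint M₂).coord :=
  Real.exp_pos _

theorem coord_upper_neg (u : M₂) : (MarkedPoint.upper u).coord < 0 :=
  neg_lt_zero.2 (Real.exp_pos _)

theorem coord_upper_lt {u v : M₂} :
    (MarkedPoint.upper u).coord < (MarkedPoint.upper v).coord ↔ v < u := by
  simp [MarkedPoint.coord, Real.pi_pos]

theorem coord_injective : Function.Injective (MarkedPoint.coord (M₂ := M₂)) := by
  intro P Q h
  have hpi := Real.pi_pos.ne'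
  rcases P with i | u <;> rcases Q with j | v
  · simpa [MarkedPoint.coord, hpi] using h
  · exact absurd h ((coord_upper_neg v).trans (coord_lower_pos i)).ne'
  · exact absurd h ((coord_upper_neg u).trans (coord_lower_pos j)).ne
  · simpa [MarkedPoint.coord, hpi, SetCoe.ext_iff] using h

theorem coord_ne_zero (P : MarkedPoint M₂) : P.coord ≠ 0 := by
  rcases P with i | u
  · exact (coord_lower_pos i).ne'
  · exact (coord_upper_neg u).ne

theorem toHalfPlane_pos (P : MarkedPoint M₂) : toHalfPlane P.pos = P.coord := by
  rcases P with i | u <;> apply Complex.ext <;>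
    simp [toHalfPlane, MarkedPoint.pos, MarkedPoint.coord, Complex.exp_re, Complex.exp_im]

/-- The pairs of marked points `{P, Q}` and `{R, S}` separate each other on the boundary. -/
def Crosses (P Q R S : MarkedPoint M₂) : Prop :=
  (P.coord - R.coord) * (P.coord - S.coord) * (Q.coord - R.coord) * (Q.coord - S.coord) < 0

/-- Half circles with nonzero end points avoid `0`, the only point of the closed half plane missed
by `toHalfPlane`, so they pull back to the strip. -/
theorem exists_simpleCurve {P Q : MarkedPoint M₂} (hPQ : P ≠ Q) :
    ∃ γ : Path P.pos Q.pos, IsSimpleCurve γ ∧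
      ∀ s, toHalfPlane (γ s) = halfCircle P.coord Q.coord s := by
  have hab : P.coord ≠ Q.coord := coord_injective.ne hPQ
  have hne := halfCircle_ne_zero hab (coord_ne_zero P) (coord_ne_zero Q)
  have hE : ∀ s, toHalfPlane (ofHalfPlane (halfCircle P.coord Q.coord s)) =
      halfCircle P.coord Q.coord s := fun s => toHalfPlane_ofHalfPlane (hne s)
  have hc : Continuous fun s => upperLog (halfCircle P.coord Q.coord s) :=
    continuous_iff_continuousAt.2 fun s =>
      ContinuousAt.comp (f := fun s => (halfCircle P.coord Q.coord s : ℂ))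
        (continuousAt_upperLog (hne s) (halfCircle P.coord Q.coord s).2)
        (continuous_subtype_val.comp (continuous_halfCircle _ _)).continuousAt
  refine ⟨⟨⟨fun s => ofHalfPlane (halfCircle P.coord Q.coord s), ?_⟩, ?_, ?_⟩, ⟨?_, ?_⟩, hE⟩
  · refine Continuous.subtype_mk ?_ _
    exact ((Complex.continuous_re.comp hc).div_const _).prodMk
      ((Complex.continuous_im.comp hc).div_const _)
  · apply toHalfPlane_injective
    simp only [hE, toHalfPlane_pos]
    apply Complex.ext <;> simp [halfCircle]
  · apply toHalfPlane_injective
    simp only [hE, toHalfPlane_pos]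
    apply Complex.ext <;> simp [halfCircle]
  · intro s t h
    have := congrArg toHalfPlane h
    erw [hE, hE] at this
    exact halfCircle_injective hab (Subtype.ext this)
  · intro s h0 h1
    have := upperLog_im_mem_of_pos (halfCircle_im_pos hab h0 h1)
    exact ⟨div_pos this.1 Real.pi_pos, (div_lt_one Real.pi_pos).2 this.2⟩

theorem compatible_of_not_crosses {P Q R S : MarkedPoint M₂} (hPQ : P ≠ Q) (hRS : R ≠ S)
    (hne : s(P, Q) ≠ s(R, S)) (h : ¬ Crosses P Q R S) : Compatible s(P, Q) s(R, S) := by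
  obtain ⟨γ, hγ, hγ'⟩ := exists_simpleCurve hPQ
  obtain ⟨δ, hδ, hδ'⟩ := exists_simpleCurve hRS
  refine ⟨P, Q, R, S, γ, δ, rfl, rfl, hγ, hδ, fun s t hst => ?_⟩
  refine halfCircle_eq_imp (coord_injective.ne hPQ) (coord_injective.ne hRS) ?_ ?_ (not_lt.1 h)
    (s := s) (t := t) (Subtype.ext ?_)
  · rintro ⟨h1, h2⟩
    exact hne (by rw [coord_injective h1, coord_injective h2])
  · rintro ⟨h1, h2⟩
    exact hne (by rw [coord_injective h1, coord_injective h2, Sym2.eq_swap])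
  · rw [← hγ', ← hδ', hst]

theorem crosses_swap_left {P Q R S : MarkedPoint M₂} (h : Crosses P Q R S) : Crosses Q P R S := by
  unfold Crosses at *; linarith

theorem crosses_swap_right {P Q R S : MarkedPoint M₂} (h : Crosses P Q R S) : Crosses P Q S R := by
  unfold Crosses at *; linarith

theorem crosses_comm {P Q R S : MarkedPoint M₂} (h : Crosses P Q R S) : Crosses R S P Q := by
  unfold Crosses at *; linarith

/-- Any two representatives meet; a meeting point allowed by compatibility would be a shared end
point, which makes the product in `Crosses` vanish. -/
theorem not_compatible_of_crosses {P Q R S : MarkedPoint M₂} (h : Crosses P Q R S) :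
    ¬ Compatible s(P, Q) s(R, S) := by
  rintro ⟨P', Q', R', S', γ, δ, he, hf, -, -, hγδ⟩
  have h' : Crosses P' Q' R' S' := by
    rw [Sym2.eq_iff] at he hf
    rcases he with ⟨rfl, rfl⟩ | ⟨rfl, rfl⟩ <;> rcases hf with ⟨rfl, rfl⟩ | ⟨rfl, rfl⟩
    · exact h
    · exact crosses_swap_right h
    · exact crosses_swap_left h
    · exact crosses_swap_left (crosses_swap_right h)
  obtain ⟨s, t, hst⟩ := exists_eq_of_separated (γ := fun s => toHalfPlane (γ.extend s))
    (δ := fun s => toHalfPlane (δ.extend s))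
    (continuous_toHalfPlane.comp γ.continuous_extend)
    (continuous_toHalfPlane.comp δ.continuous_extend)
    (fun _ => toHalfPlane_im_nonneg _) (fun _ => toHalfPlane_im_nonneg _)
    (by simp [toHalfPlane_pos]) (by simp [toHalfPlane_pos])
    (by simp [toHalfPlane_pos]) (by simp [toHalfPlane_pos]) h'
  have hst' := toHalfPlane_injective hst
  obtain ⟨hs, ht⟩ := hγδ _ _ hst'
  have hend : ∀ {A B : MarkedPoint M₂} (ε : Path A.pos B.pos) (u : unitInterval),
      u = 0 ∨ u = 1 → toHalfPlane (ε u) = A.coord ∨ toHalfPlane (ε u) = B.coord := by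
    rintro A B ε u (rfl | rfl)
    · left; rw [ε.source, toHalfPlane_pos]
    · right; rw [ε.target, toHalfPlane_pos]
  have h1 := hend γ _ hs
  have h2 := hend δ _ ht
  have h3 : toHalfPlane (γ (projIcc 0 1 zero_le_one s)) =
    toHalfPlane (δ (projIcc 0 1 zero_le_one t)) := hst
  unfold Crosses at h'
  rcases h1 with h1 | h1 <;> rcases h2 with h2 | h2 <;> rw [h1, h2, Complex.ofReal_inj] at h3 <;>
    simp [h3] at h'

end Compatible

/-! ### Neighbours and triangles at a marked point. -/

section Triangulation

variable {M₂ : Set ℤ} {T : Set (Sym2 (MarkedPoint M₂))}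

theorem not_crosses_of_isBoundarySegment {P Q : MarkedPoint M₂} (h : IsBoundarySegment P Q)
    (R S : MarkedPoint M₂) : ¬ Crosses P Q R S := by
  have key : ∀ X : MarkedPoint M₂, 0 ≤ (P.coord - X.coord) * (Q.coord - X.coord) := by
    intro X
    by_contra! hX
    have hb : P.coord < X.coord ∧ X.coord < Q.coord ∨ Q.coord < X.coord ∧ X.coord < P.coord := by
      rcases mul_neg_iff.1 hX with ⟨h1, h2⟩ | ⟨h1, h2⟩
      · exact Or.inr ⟨by linarith, by linarith⟩
      · exact Or.inl ⟨by linarith, by linarith⟩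
    rcases P with i | u <;> rcases Q with j | v <;> rcases X with k | w <;>
      simp only [IsBoundarySegment, coord_lower_lt, coord_upper_lt] at h hb
    · rcases h with h | h
      · rcases hb with hb | hb
        · exact h.2 hb.1 hb.2
        · exact absurd (hb.1.trans hb.2) h.1.not_gt
      · rcases hb with hb | hb
        · exact absurd (hb.1.trans hb.2) h.1.not_gt
        · exact h.2 hb.1 hb.2
    · have := coord_upper_neg w
      have h1 := coord_lower_pos (M₂ := M₂) i
      have h2 := coord_lower_pos (M₂ := M₂) j
      rcases hb with hb | hb <;> linarith [hb.1, hb.2]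
    · have := coord_lower_pos (M₂ := M₂) k
      have h1 := coord_upper_neg u
      have h2 := coord_upper_neg v
      rcases hb with hb | hb <;> linarith [hb.1, hb.2]
    · rcases h with h | h
      · rcases hb with hb | hb
        · exact absurd (hb.2.trans hb.1) h.1.not_gt
        · exact h.2 hb.2 hb.1
      · rcases hb with hb | hb
        · exact h.2 hb.2 hb.1
        · exact absurd (hb.2.trans hb.1) h.1.not_gt
  unfold Crosses
  nlinarith [mul_nonneg (key R) (key S)]

theorem not_crosses_of_adj (hT : IsTriangulation T) {P Q R S : MarkedPoint M₂}
    (h : (sideGraph T).Adj P Q) (h' : (sideGraph T).Adj R S) : ¬ Crosses P Q R S := by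
  rcases h.2 with hb | hPQ
  · exact not_crosses_of_isBoundarySegment hb R S
  rcases h'.2 with hb | hRS
  · exact fun hc => not_crosses_of_isBoundarySegment hb P Q (crosses_comm hc)
  intro hc
  by_cases he : s(P, Q) = s(R, S)
  · rw [Sym2.eq_iff] at he
    rcases he with ⟨rfl, rfl⟩ | ⟨rfl, rfl⟩ <;> simp [Crosses] at hc
  · exact not_compatible_of_crosses hc (hT.prop.2 hPQ hRS he)

theorem compatible_comm {e f : Sym2 (MarkedPoint M₂)} (h : Compatible e f) : Compatible f e := by
  obtain ⟨P, Q, R, S, γ, δ, h1, h2, h3, h4, h5⟩ := h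
  exact ⟨R, S, P, Q, δ, γ, h2, h1, h4, h3, fun s t hst => (h5 t s hst.symm).symm⟩

theorem adj_of_mem (hT : IsTriangulation T) {P Q : MarkedPoint M₂} (h : s(P, Q) ∈ T) :
    (sideGraph T).Adj P Q := by
  refine ⟨?_, Or.inr h⟩
  obtain ⟨R, S, he, hne, -⟩ := hT.prop.1 _ h
  rw [Sym2.eq_iff] at he
  rcases he with ⟨rfl, rfl⟩ | ⟨rfl, rfl⟩
  · exact hne
  · exact hne.symm

/-- By maximality, marked points which are not joined in `T` are separated by an arc of `T`. -/
theorem exists_crosses (hT : IsTriangulation T) {P Q : MarkedPoint M₂} (hPQ : P ≠ Q)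
    (h : ¬ (sideGraph T).Adj P Q) : ∃ R S, (sideGraph T).Adj R S ∧ Crosses P Q R S := by
  by_contra! hno
  refine h (adj_of_mem hT (hT.mem_of_prop_insert ⟨?_, ?_⟩))
  · rintro e (rfl | he)
    · exact ⟨P, Q, rfl, hPQ, fun hb => h ⟨hPQ, Or.inl hb⟩⟩
    · exact hT.prop.1 e he
  · refine hT.prop.2.insert fun f hf hne => ?_
    have : Compatible s(P, Q) f := by
      induction f with
      | _ R S =>
        have hRS := adj_of_mem hT hf
        exact compatible_of_not_crosses hPQ hRS.1 hne (hno R S hRS)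
    exact ⟨this, compatible_comm this⟩

/-- Consecutive neighbours of a marked point are joined. -/
theorem adj_of_consecutive (hT : IsTriangulation T) {K A B : MarkedPoint M₂}
    (hA : (sideGraph T).Adj K A) (hB : (sideGraph T).Adj K B) (hAB : A ≠ B)
    (h : ∀ C, (sideGraph T).Adj K C → ¬ Crosses K C A B) : (sideGraph T).Adj A B := by
  by_contra hn
  obtain ⟨R, S, hRS, hc⟩ := exists_crosses hT hAB hn
  by_cases hR : R = K
  · subst hR
    exact h S hRS (crosses_comm hc)
  by_cases hS : S = K
  · subst hS
    exact h R hRS.symm (crosses_swap_left (crosses_comm hc))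
  have h1 := not_crosses_of_adj hT hA hRS
  have h2 := not_crosses_of_adj hT hB hRS
  unfold Crosses at hc h1 h2
  rw [not_lt] at h1 h2
  -- `K` lies on one side of `RS`; as `KA` and `KB` do not cross `RS`, both `A` and `B` lie on that
  -- side too or on its boundary. Multiplying the two inequalities brings in `Z ^ 2 > 0`,
  -- contradicting `hc`.
  have hZ : (K.coord - R.coord) * (K.coord - S.coord) ≠ 0 :=
    mul_ne_zero (sub_ne_zero.2 (coord_injective.ne (Ne.symm hR)))
      (sub_ne_zero.2 (coord_injective.ne (Ne.symm hS)))
  set Z := (K.coord - R.coord) * (K.coord - S.coord)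
  have hZ2 : 0 < Z ^ 2 := by positivity
  rw [mul_assoc] at hc h1 h2
  nlinarith [mul_nonneg h1 h2]

/-- The position of marked points as seen from `K`. -/
noncomputable def coordFrom (K A : MarkedPoint M₂) : ℝ := (K.coord - A.coord)⁻¹

theorem coordFrom_injective (K : MarkedPoint M₂) : Function.Injective (coordFrom K) := by
  intro A B h
  have := inv_injective h
  exact coord_injective (by linarith)

/-- The Möbius map `z ↦ 1 / (K - z)` sends `K` to infinity, so separation of `K` from `C` becomes
strict betweenness of `C` on the line. -/
theorem crosses_iff_coordFrom {K A B C : MarkedPoint M₂} (hA : K ≠ A) (hB : K ≠ B) (hC : K ≠ C) :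
    Crosses K C A B ↔
      (coordFrom K C - coordFrom K A) * (coordFrom K C - coordFrom K B) < 0 := by
  have a := sub_ne_zero.2 (coord_injective.ne hA)
  have b := sub_ne_zero.2 (coord_injective.ne hB)
  have c := sub_ne_zero.2 (coord_injective.ne hC)
  have e : (coordFrom K C - coordFrom K A) * (coordFrom K C - coordFrom K B) =
      ((K.coord - A.coord) * (K.coord - B.coord) * (C.coord - A.coord) * (C.coord - B.coord)) *
      ((K.coord - A.coord) * (K.coord - B.coord) * (K.coord - C.coord))⁻¹ ^ 2 := by
    unfold coordFrom
    field_simp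
    ring
  have hpos : 0 < ((K.coord - A.coord) * (K.coord - B.coord) * (K.coord - C.coord))⁻¹ ^ 2 := by
    positivity
  rw [e]
  exact ⟨fun h => mul_neg_of_neg_of_pos h hpos, fun h => neg_of_mul_neg_left h hpos.le⟩

/-- The neighbours of a marked point in the triangulation. -/
def nbrs (T : Set (Sym2 (MarkedPoint M₂))) (P : MarkedPoint M₂) : Set (MarkedPoint M₂) :=
  {Q | (sideGraph T).Adj P Q}

theorem adj_lower_succ (i : ℤ) :
    (sideGraph T).Adj (.lower i : MarkedPoint M₂) (.lower (i + 1)) := by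
  refine ⟨by simp, Or.inl (Or.inl ?_)⟩
  exact Order.covBy_add_one i

theorem finite_nbrs (hadm : IsAdmissible T) (i : ℤ) :
    (nbrs T (.lower i : MarkedPoint M₂)).Finite := by
  have h1 : {Q : MarkedPoint M₂ | s(.lower i, Q) ∈ T}.Finite := by
    refine Set.Finite.of_finite_image (f := fun Q => s(MarkedPoint.lower i, Q))
      ((hadm i).subset ?_) ?_
    · rintro _ ⟨Q, hQ, rfl⟩
      exact ⟨hQ, Sym2.mem_mk_left _ _⟩
    · intro Q _ R _ h
      exact Sym2.congr_right.1 h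
  refine (h1.union (Set.toFinite {.lower (i + 1), .lower (i - 1)})).subset ?_
  rintro Q ⟨-, hb | hQ⟩
  · right
    rcases Q with j | u
    · rcases hb with hb | hb
      · left; rw [Order.covBy_iff_add_one_eq] at hb; rw [hb]
      · right; rw [Order.covBy_iff_add_one_eq] at hb; simp [← hb]
    · exact hb.elim
  · exact Or.inl hQ

theorem trianglesAt_eq (P : MarkedPoint M₂) [DecidableEq (MarkedPoint M₂)] :
    trianglesAt T P = {Δ | ∃ A B, (sideGraph T).Adj P A ∧ (sideGraph T).Adj P B ∧
      (sideGraph T).Adj A B ∧ coordFrom P A < coordFrom P B ∧ Δ = {P, A, B}} := by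
  ext Δ
  constructor
  · rintro ⟨hΔ, hP⟩
    have hcard : (Δ.erase P).card = 2 := by
      rw [Finset.card_erase_of_mem hP, hΔ.card_eq]
    obtain ⟨A, B, hAB, he⟩ := Finset.card_eq_two.1 hcard
    have hins : Δ = {P, A, B} := by rw [← Finset.insert_erase hP, he]
    have hcl := hΔ.isClique
    rw [hins] at hcl
    have hPA : P ≠ A := by rintro rfl; exact Finset.notMem_erase P Δ (by rw [he]; simp)
    have hPB : P ≠ B := by rintro rfl; exact Finset.notMem_erase P Δ (by rw [he]; simp)
    have h1 := hcl (by simp) (by simp) hPA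
    have h2 := hcl (by simp) (by simp) hPB
    have h3 := hcl (by simp) (by simp) hAB
    rcases lt_or_gt_of_ne ((coordFrom_injective P).ne hAB) with h | h
    · exact ⟨A, B, h1, h2, h3, h, hins⟩
    · exact ⟨B, A, h2, h1, h3.symm, h, by rw [hins, Finset.pair_comm]⟩
  · rintro ⟨A, B, h1, h2, h3, -, rfl⟩
    exact ⟨SimpleGraph.is3Clique_triple_iff.2 ⟨h1, h2, h3⟩, by simp⟩

/-- The triangles at a marked point are the gaps between its consecutive neighbours. -/
theorem finite_trianglesAt_and_ncard (hT : IsTriangulation T) (hadm : IsAdmissible T) (i : ℤ) :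
    (trianglesAt T (.lower i)).Finite ∧
      (trianglesAt T (.lower i)).ncard + 1 = (nbrs T (.lower i)).ncard := by
  classical
  set K : MarkedPoint M₂ := .lower i
  have hfin : (nbrs T K).Finite := finite_nbrs hadm i
  obtain ⟨M, hM, hMmax⟩ := Set.exists_max_image (nbrs T K) (coordFrom K) hfin
    ⟨_, adj_lower_succ i⟩
  have hsucc : ∀ A ∈ nbrs T K \ {M}, ∃ B ∈ nbrs T K, coordFrom K A < coordFrom K B ∧
      ∀ C ∈ nbrs T K, coordFrom K A < coordFrom K C → coordFrom K B ≤ coordFrom K C := by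
    rintro A ⟨hA, hAM⟩
    obtain ⟨B, ⟨hB, hAB⟩, hmin⟩ := Set.exists_min_image
      {B ∈ nbrs T K | coordFrom K A < coordFrom K B} (coordFrom K)
      (hfin.subset (Set.sep_subset _ _))
      ⟨M, hM, lt_of_le_of_ne (hMmax A hA) ((coordFrom_injective K).ne hAM)⟩
    exact ⟨B, hB, hAB, fun C hC hAC => hmin C ⟨hC, hAC⟩⟩
  choose! succ hs1 hs2 hs3 using hsucc
  have himg : (fun A => ({K, A, succ A} : Finset (MarkedPoint M₂))) '' (nbrs T K \ {M}) =
      trianglesAt T K := by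
    rw [trianglesAt_eq]
    ext Δ
    constructor
    · rintro ⟨A, hA, rfl⟩
      refine ⟨A, succ A, hA.1, hs1 A hA, ?_, hs2 A hA, rfl⟩
      refine adj_of_consecutive hT hA.1 (hs1 A hA)
        (fun h => (hs2 A hA).ne (congrArg (coordFrom K) h)) fun C hC hc => ?_
      rw [crosses_iff_coordFrom hA.1.1 (hs1 A hA).1 hC.1, mul_neg_iff] at hc
      have h2 := hs2 A hA
      rcases hc with ⟨h3, h4⟩ | ⟨h3, h4⟩
      · linarith [hs3 A hA C hC (by linarith)]
      · linarith
    · rintro ⟨A, B, hA, hB, hAB, hlt, rfl⟩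
      have hA' : A ∈ nbrs T K \ {M} := by
        refine ⟨hA, ?_⟩
        rintro rfl
        exact hlt.not_ge (hMmax B hB)
      refine ⟨A, hA', ?_⟩
      suffices succ A = B by simp only [this]
      by_contra hne
      -- A neighbour strictly between `A` and `B` would give a side from `K` crossing `AB`.
      have h1 := (hs3 A hA' B hB hlt).lt_of_ne ((coordFrom_injective K).ne hne)
      refine not_crosses_of_adj hT (hs1 A hA') hAB ?_
      rw [crosses_iff_coordFrom hA.1 hB.1 (hs1 A hA').1]
      exact mul_neg_of_pos_of_neg (sub_pos.2 (hs2 A hA')) (sub_neg.2 h1)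
  have hinj : Set.InjOn (fun A => ({K, A, succ A} : Finset (MarkedPoint M₂)))
      (nbrs T K \ {M}) := by
    intro A hA A' hA' h
    simp only at h
    have h1 : A ∈ ({K, A', succ A'} : Finset (MarkedPoint M₂)) := by rw [← h]; simp
    have h2 : A' ∈ ({K, A, succ A} : Finset (MarkedPoint M₂)) := by
      rw [h]; simp
    simp only [Finset.mem_insert, Finset.mem_singleton] at h1 h2
    by_contra hne
    have h1' := (h1.resolve_left hA.1.1.symm).resolve_left hne
    have h2' := (h2.resolve_left hA'.1.1.symm).resolve_left (Ne.symm hne)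
    have h3 := hs2 A hA
    have h4 := hs2 A' hA'
    rw [← h1'] at h4
    rw [← h2'] at h3
    exact lt_asymm h3 h4
  rw [← himg]
  refine ⟨hfin.sdiff.image _, ?_⟩
  rw [hinj.ncard_image]
  exact Set.ncard_sdiff_singleton_add_one hM hfin

end Triangulation

/-! ### The quiddity recurrence along peripheral arcs. -/

section LowerBoundary

variable {M₂ : Set ℤ} {T : Set (Sym2 (MarkedPoint M₂))}

/-- Adjacency of points of the lower boundary line. -/
def LowerAdj (T : Set (Sym2 (MarkedPoint M₂))) (i j : ℤ) : Prop :=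
  (sideGraph T).Adj (.lower i) (.lower j)

theorem LowerAdj.symm {i j : ℤ} (h : LowerAdj T i j) : LowerAdj T j i :=
  SimpleGraph.Adj.symm h

theorem lowerAdj_iff {i j : ℤ} (hij : i < j) :
    LowerAdj T i j ↔ j = i + 1 ∨ s(MarkedPoint.lower i, MarkedPoint.lower j) ∈ T := by
  have hb : IsBoundarySegment (.lower i : MarkedPoint M₂) (.lower j) ↔ j = i + 1 := by
    simp only [IsBoundarySegment, Order.covBy_iff_add_one_eq]
    omega
  have hne : (.lower i : MarkedPoint M₂) ≠ .lower j := by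
    simpa using hij.ne
  unfold LowerAdj
  simp only [sideGraph, hb]
  exact and_iff_right hne

theorem not_lowerAdj_of_lt (hT : IsTriangulation T) {a b c d : ℤ} (hab : a < b) (hbc : b < c)
    (hcd : c < d) (h : LowerAdj T a c) : ¬ LowerAdj T b d := by
  intro h'
  refine not_crosses_of_adj hT h h' ?_
  have h1 := coord_lower_lt (M₂ := M₂).2 hab
  have h2 := coord_lower_lt (M₂ := M₂).2 hbc
  have h3 := coord_lower_lt (M₂ := M₂).2 hcd
  unfold Crosses
  exact mul_neg_of_pos_of_neg (mul_pos (mul_pos_of_neg_of_neg (by linarith) (by linarith))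
    (by linarith)) (by linarith)

open Classical in
/-- The neighbours of `x` on the lower boundary line strictly between `i` and `j`. -/
noncomputable def innerNbrs (T : Set (Sym2 (MarkedPoint M₂))) (x i j : ℤ) : Finset ℤ :=
  {k ∈ Finset.Ioo i j | LowerAdj T x k}

theorem mem_innerNbrs {x i j k : ℤ} :
    k ∈ innerNbrs T x i j ↔ (i < k ∧ k < j) ∧ LowerAdj T x k := by
  simp [innerNbrs]

/-- The neighbours of `x` on the lower boundary line between its neighbours `p` and `y`. -/
noncomputable def nbrsBetween (T : Set (Sym2 (MarkedPoint M₂))) (p x y : ℤ) : Finset ℤ :=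
  insert p (insert y (innerNbrs T x p x ∪ innerNbrs T x x y))

theorem mem_nbrsBetween {p x y k : ℤ} (hpx : p < x) (hxy : x < y) (hp : LowerAdj T x p)
    (hy : LowerAdj T x y) : k ∈ nbrsBetween T p x y ↔ (p ≤ k ∧ k ≤ y) ∧ LowerAdj T x k := by
  simp only [nbrsBetween, Finset.mem_insert, Finset.mem_union, mem_innerNbrs]
  constructor
  · rintro (rfl | rfl | h | h)
    · exact ⟨by omega, hp⟩
    · exact ⟨by omega, hy⟩
    · exact ⟨by omega, h.2⟩
    · exact ⟨by omega, h.2⟩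
  · rintro ⟨h, h'⟩
    have hne : x ≠ k := by
      rintro rfl
      exact h'.1 rfl
    rcases eq_or_ne k p with h1 | h1
    · exact Or.inl h1
    rcases eq_or_ne k y with h2 | h2
    · exact Or.inr (Or.inl h2)
    rcases lt_or_gt_of_ne hne with h3 | h3
    · exact Or.inr (Or.inr (Or.inr ⟨by omega, h'⟩))
    · exact Or.inr (Or.inr (Or.inl ⟨by omega, h'⟩))

theorem card_nbrsBetween {p x y : ℤ} (hpx : p < x) (hxy : x < y) :
    (nbrsBetween T p x y).card = (innerNbrs T x p x).card + (innerNbrs T x x y).card + 2 := by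
  have hd : Disjoint (innerNbrs T x p x) (innerNbrs T x x y) := by
    rw [Finset.disjoint_left]
    intro k h1 h2
    rw [mem_innerNbrs] at h1 h2
    omega
  rw [nbrsBetween, Finset.card_insert_of_notMem, Finset.card_insert_of_notMem,
    Finset.card_union_of_disjoint hd]
  · simp only [Finset.mem_union, mem_innerNbrs]; omega
  · simp only [Finset.mem_insert, Finset.mem_union, mem_innerNbrs]; omega

theorem lower_injective : Function.Injective (MarkedPoint.lower : ℤ → MarkedPoint M₂) :=
  fun _ _ h => by simpa using h

/-- A marked point which is not on the lower boundary line between `p` and `y` is separated from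
those which are. -/
theorem crosses_of_notMem {p x y : ℤ} (hpx : p < x) (hxy : x < y) {C : MarkedPoint M₂}
    (hC : ∀ c, C = .lower c → c < p ∨ y < c) : Crosses (.lower x) C (.lower p) (.lower y) := by
  have h1 := coord_lower_lt (M₂ := M₂).2 hpx
  have h2 := coord_lower_lt (M₂ := M₂).2 hxy
  have h3 : 0 < (C.coord - (MarkedPoint.lower p : MarkedPoint M₂).coord) *
      (C.coord - (MarkedPoint.lower y : MarkedPoint M₂).coord) := by
    rcases C with c | u
    · rcases hC c rfl with h | h
      · have := coord_lower_lt (M₂ := M₂).2 h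
        exact mul_pos_of_neg_of_neg (by linarith) (by linarith)
      · have := coord_lower_lt (M₂ := M₂).2 h
        exact mul_pos (by linarith) (by linarith)
    · have := coord_upper_neg u
      have h4 := coord_lower_pos (M₂ := M₂) p
      exact mul_pos_of_neg_of_neg (by linarith) (by linarith)
  unfold Crosses
  rw [mul_assoc]
  exact mul_neg_of_neg_of_pos (mul_neg_of_pos_of_neg (by linarith) (by linarith)) h3

/-- The side from `p` to `y` encloses `x`, so `x` has no neighbours outside `nbrsBetween T p x y`.
-/
theorem ncard_trianglesAt_of_adj (hT : IsTriangulation T) (hadm : IsAdmissible T) {p x y : ℤ}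
    (hpx : p < x) (hxy : x < y) (hp : LowerAdj T p x) (hy : LowerAdj T x y)
    (hpy : LowerAdj T p y) : (trianglesAt T (.lower x)).ncard =
      (innerNbrs T x p x).card + (innerNbrs T x x y).card + 1 := by
  have h1 := (finite_trianglesAt_and_ncard hT hadm x).2
  have h2 : nbrs T (.lower x) = MarkedPoint.lower '' (nbrsBetween T p x y : Set ℤ) := by
    ext C
    constructor
    · intro hC
      by_contra hn
      refine not_crosses_of_adj hT hC hpy (crosses_of_notMem hpx hxy ?_)
      rintro c rfl
      by_contra! h
      exact hn ⟨c, (mem_nbrsBetween hpx hxy hp.symm hy).2 ⟨h, hC⟩, rfl⟩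
    · rintro ⟨c, hc, rfl⟩
      exact ((mem_nbrsBetween hpx hxy hp.symm hy).1 hc).2
  rw [h2, Set.ncard_image_of_injective _ lower_injective, Set.ncard_coe_finset,
    card_nbrsBetween hpx hxy] at h1
  omega

/-- Were all neighbours of `x` between `p` and `y`, then `p` and `y` would be the extreme ones and
hence joined by `adj_of_consecutive`. So there is at least one more neighbour, hence one more
triangle. -/
theorem le_ncard_trianglesAt_of_not_adj (hT : IsTriangulation T) (hadm : IsAdmissible T)
    {p x y : ℤ} (hpx : p < x) (hxy : x < y) (hp : LowerAdj T p x) (hy : LowerAdj T x y)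
    (hpy : ¬ LowerAdj T p y) : (innerNbrs T x p x).card + (innerNbrs T x x y).card + 2 ≤
      (trianglesAt T (.lower x)).ncard := by
  have h1 := (finite_trianglesAt_and_ncard hT hadm x).2
  have hsub : MarkedPoint.lower '' (nbrsBetween T p x y : Set ℤ) ⊆ nbrs T (.lower x) := by
    rintro _ ⟨c, hc, rfl⟩
    exact ((mem_nbrsBetween hpx hxy hp.symm hy).1 hc).2
  have hss : MarkedPoint.lower '' (nbrsBetween T p x y : Set ℤ) ⊂ nbrs T (.lower x) := by
    refine hsub.ssubset_of_ne fun he => hpy ?_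
    refine adj_of_consecutive hT hp.symm hy
      (lower_injective.ne (hpx.trans hxy).ne) fun C hC => ?_
    have hC' : C ∈ nbrs T (.lower x) := hC
    rw [← he] at hC'
    obtain ⟨c, hc, rfl⟩ := hC'
    have hc := ((mem_nbrsBetween hpx hxy hp.symm hy).1 hc).1
    have g1 := coord_lower_lt (M₂ := M₂).2 hpx
    have g2 := coord_lower_lt (M₂ := M₂).2 hxy
    have g3 := not_lt.1 ((coord_lower_lt (M₂ := M₂)).not.2 hc.1.not_gt)
    have g4 := not_lt.1 ((coord_lower_lt (M₂ := M₂)).not.2 hc.2.not_gt)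
    unfold Crosses
    rw [not_lt, mul_assoc]
    exact mul_nonneg_of_nonpos_of_nonpos
      (mul_nonpos_of_nonneg_of_nonpos (by linarith) (by linarith))
      (mul_nonpos_of_nonneg_of_nonpos (by linarith) (by linarith))
  have h2 := Set.ncard_lt_ncard hss (finite_nbrs hadm x)
  rw [Set.ncard_image_of_injective _ lower_injective, Set.ncard_coe_finset,
    card_nbrsBetween hpx hxy] at h2
  omega

/-- The neighbour `k` of `i` preceding its neighbour `j` is joined to `j`. -/
theorem lowerAdj_of_consecutive (hT : IsTriangulation T) {i j k : ℤ} (hik : i < k) (hkj : k < j)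
    (hk : LowerAdj T i k) (hj : LowerAdj T i j)
    (h : ∀ c, k < c → c < j → ¬ LowerAdj T i c) : LowerAdj T k j := by
  refine adj_of_consecutive hT hk hj (lower_injective.ne hkj.ne) fun C hC => ?_
  have g1 := coord_lower_lt (M₂ := M₂).2 hik
  have g2 := coord_lower_lt (M₂ := M₂).2 hkj
  unfold Crosses
  rw [not_lt, mul_assoc]
  refine mul_nonneg (mul_pos_of_neg_of_neg (by linarith) (by linarith)).le ?_
  by_cases hc : C.coord ≤ (MarkedPoint.lower k : MarkedPoint M₂).coord
  · exact mul_nonneg_of_nonpos_of_nonpos (by linarith) (by linarith)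
  · refine mul_nonneg (by linarith) (sub_nonneg.2 ?_)
    by_contra! hc'
    rcases C with c | u
    · rw [not_le] at hc
      exact h c (coord_lower_lt.1 hc) (coord_lower_lt.1 hc') hC
    · exact hc ((coord_upper_neg u).trans (coord_lower_pos k)).le

variable {f : ℤ → ℤ}

/-- Transport of a solution of the recurrence along an arc. -/
theorem recurrence_of_lowerAdj (hT : IsTriangulation T) (hadm : IsAdmissible T)
    (hf : ∀ k, f (k + 1) + f (k - 1) = (trianglesAt T (.lower k)).ncard * f k) {i j : ℤ}
    (hij : i < j) (h : LowerAdj T i j) :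
    f (i + 1) = f j + (innerNbrs T i i j).card * f i ∧
      f (j - 1) = f i + (innerNbrs T j i j).card * f j := by
  induction hn : (j - i).toNat using Nat.strong_induction_on generalizing i j with
  | _ n ih =>
  rcases eq_or_ne j (i + 1) with rfl | hne
  · have h0 : ∀ x, innerNbrs T x i (i + 1) = ∅ := by
      intro x
      rw [Finset.eq_empty_iff_forall_notMem]
      intro k hk
      rw [mem_innerNbrs] at hk
      omega
    simp [h0]
  -- `k` is the third vertex of the triangle under the arc. The induction hypotheses for `(i, k)`
  -- and `(k, j)`, put into the recurrence at `k`, yield `f k = f i + f j`.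
  obtain ⟨k, hk, hmax⟩ := Finset.exists_max_image (innerNbrs T i i j) id
    ⟨i + 1, mem_innerNbrs.2 ⟨by omega, adj_lower_succ i⟩⟩
  simp only [id] at hmax
  obtain ⟨⟨hik, hkj⟩, hadj⟩ := mem_innerNbrs.1 hk
  have hadj' : LowerAdj T k j := by
    refine lowerAdj_of_consecutive hT hik hkj hadj h fun c h1 h2 hc => ?_
    have := hmax c (mem_innerNbrs.2 ⟨by omega, hc⟩)
    omega
  obtain ⟨a1, a2⟩ := ih _ (by omega) hik hadj rfl
  obtain ⟨b1, b2⟩ := ih _ (by omega) hkj hadj' rfl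
  have hq := ncard_trianglesAt_of_adj hT hadm hik hkj hadj hadj' h
  have e1 : innerNbrs T i i j = insert k (innerNbrs T i i k) := by
    ext c
    simp only [Finset.mem_insert, mem_innerNbrs]
    constructor
    · intro hc
      have := hmax c (mem_innerNbrs.2 hc)
      rcases eq_or_ne c k with h0 | h0
      · exact Or.inl h0
      · exact Or.inr ⟨by omega, hc.2⟩
    · rintro (rfl | hc)
      · exact ⟨⟨hik, hkj⟩, hadj⟩
      · exact ⟨by omega, hc.2⟩
  have e2 : innerNbrs T j i j = insert k (innerNbrs T j k j) := by
    ext c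
    simp only [Finset.mem_insert, mem_innerNbrs]
    constructor
    · intro hc
      rcases lt_trichotomy c k with h0 | h0 | h0
      · exact absurd hc.2.symm (not_lowerAdj_of_lt hT hc.1.1 h0 hkj hadj)
      · exact Or.inl h0
      · exact Or.inr ⟨by omega, hc.2⟩
    · rintro (rfl | hc)
      · exact ⟨⟨hik, hkj⟩, hadj'.symm⟩
      · exact ⟨by omega, hc.2⟩
  have n1 : k ∉ innerNbrs T i i k := fun h0 => by rw [mem_innerNbrs] at h0; omega
  have n2 : k ∉ innerNbrs T j k j := fun h0 => by rw [mem_innerNbrs] at h0; omega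
  have hr := hf k
  rw [hq] at hr
  rw [e1, e2, Finset.card_insert_of_notMem n1, Finset.card_insert_of_notMem n2]
  push_cast at hr ⊢
  constructor
  · linear_combination a1 - hr + b1 + a2
  · linear_combination b2 - hr + b1 + a2

theorem eq_one_of_lowerAdj (hT : IsTriangulation T) (hadm : IsAdmissible T)
    (hf : ∀ k, f (k + 1) + f (k - 1) = (trianglesAt T (.lower k)).ncard * f k) {i j : ℤ}
    (hij : i < j) (h : LowerAdj T i j) (h0 : f i = 0) (h1 : f (i + 1) = 1) : f j = 1 := by
  have := (recurrence_of_lowerAdj hT hadm hf hij h).1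
  rw [h0, h1] at this
  linarith

theorem exists_greatest_nbr {x j : ℤ} (hxj : x < j) :
    ∃ y, x < y ∧ y ≤ j ∧ LowerAdj T x y ∧ ∀ w, y < w → w ≤ j → ¬ LowerAdj T x w := by
  -- `innerNbrs` is strict at both ends; `j + 1` lets `y = j` compete.
  obtain ⟨y, hy, hmax⟩ := Finset.exists_max_image (innerNbrs T x x (j + 1)) id
    ⟨x + 1, mem_innerNbrs.2 ⟨by omega, adj_lower_succ x⟩⟩
  simp only [id] at hmax
  rw [mem_innerNbrs] at hy
  refine ⟨y, hy.1.1, by omega, hy.2, fun w h1 h2 hw => ?_⟩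
  have := hmax w (mem_innerNbrs.2 ⟨by omega, hw⟩)
  omega

/-- A solution of the recurrence increases along the path of longest arcs. -/
theorem two_le_of_path (hT : IsTriangulation T) (hadm : IsAdmissible T)
    (hf : ∀ k, f (k + 1) + f (k - 1) = (trianglesAt T (.lower k)).ncard * f k) {i j p x : ℤ}
    (hip : i ≤ p) (hpx : p < x) (hxj : x < j) (h : LowerAdj T p x) (hp : 0 ≤ f p)
    (hx : f p + 1 ≤ f x) (h1 : ∀ z, i ≤ z → z < p → ¬ LowerAdj T z x)
    (h2 : ∀ z w, i ≤ z → z < x → x < w → w ≤ j → ¬ LowerAdj T z w) : 2 ≤ f j := by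
  induction hn : (j - x).toNat using Nat.strong_induction_on generalizing p x with
  | _ n ih =>
  obtain ⟨y, hxy, hyj, hy, hmax⟩ := exists_greatest_nbr (T := T) hxj
  have e1 := (recurrence_of_lowerAdj hT hadm hf hpx h).2
  have e2 := (recurrence_of_lowerAdj hT hadm hf hxy hy).1
  have e3 := hf x
  have e4 := le_ncard_trianglesAt_of_not_adj hT hadm hpx hxy h hy (h2 p y hip hpx hxy hyj)
  have e5 : ((innerNbrs T x p x).card + (innerNbrs T x x y).card + 2 : ℤ) ≤
    (trianglesAt T (.lower x)).ncard := by exact_mod_cast e4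
  have hy2 : f x + 1 ≤ f y := by
    have := mul_le_mul_of_nonneg_right e5 (by linarith : 0 ≤ f x)
    rw [← e3, e1, e2] at this
    nlinarith
  rcases hyj.eq_or_lt with rfl | hyj'
  · linarith
  · refine ih _ (by omega) (by omega) hxy hyj' hy (by linarith) hy2 ?_ ?_ rfl
    · exact fun z hz hzx => h2 z y hz hzx hxy hyj
    · intro z w hz hzy hyw hwj
      rcases lt_trichotomy z x with h0 | rfl | h0
      · exact h2 z w hz h0 (by omega) hwj
      · exact hmax w hyw hwj
      · exact not_lowerAdj_of_lt hT h0 hzy hyw hy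

theorem two_le_of_not_lowerAdj (hT : IsTriangulation T) (hadm : IsAdmissible T)
    (hf : ∀ k, f (k + 1) + f (k - 1) = (trianglesAt T (.lower k)).ncard * f k) {i j : ℤ}
    (hij : i < j) (h : ¬ LowerAdj T i j) (h0 : f i = 0) (h1 : f (i + 1) = 1) : 2 ≤ f j := by
  obtain ⟨y, hiy, hyj, hy, hmax⟩ := exists_greatest_nbr (T := T) hij
  have hyj' : y < j := hyj.lt_of_ne (by rintro rfl; exact h hy)
  have hfy := eq_one_of_lowerAdj hT hadm hf hiy hy h0 h1
  refine two_le_of_path hT hadm hf le_rfl hiy hyj' hy h0.ge (by omega)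
    (fun z _ _ => by omega) fun z w hz hzy hyw hwj => ?_
  rcases hz.eq_or_lt with rfl | hz
  · exact hmax w hyw hwj
  · exact not_lowerAdj_of_lt hT hz hzy hyw hy

end LowerBoundary

/-! ### Existence and uniqueness of the frieze with a given quiddity sequence. -/

section Frieze

theorem exists_recurrence (q : ℤ → ℤ) (a b : ℤ) :
    ∃ x : ℤ → ℤ, x 0 = a ∧ x 1 = b ∧ ∀ k, x (k + 1) + x (k - 1) = q k * x k := by
  -- `u n` stores `(x n, x (n + 1))` and `d n` stores `(x (-n), x (-n + 1))`.
  let u : ℕ → ℤ × ℤ := fun n => Nat.rec (a, b) (fun n s => (s.2, q (n + 1) * s.2 - s.1)) n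
  let d : ℕ → ℤ × ℤ := fun n => Nat.rec (a, b) (fun n s => (q (-n) * s.1 - s.2, s.1)) n
  let x : ℤ → ℤ := fun k => if 0 ≤ k then (u k.toNat).1 else (d (-k).toNat).1
  have hu : ∀ n : ℕ, x n = (u n).1 := fun n => by simp [x]
  have hd : ∀ n : ℕ, x (-n) = (d n).1 := by
    intro n
    rcases n with _ | n
    · simp [x, u, d]
    · have : ¬ (0 : ℤ) ≤ -((n + 1 : ℕ) : ℤ) := by omega
      simp only [x, if_neg this, neg_neg, Int.toNat_natCast]
  have hu2 : ∀ n : ℕ, (u n).2 = x (n + 1) := fun n => (hu (n + 1)).symm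
  have hd2 : ∀ n : ℕ, (d n).2 = x (-n + 1) := by
    intro n
    rcases n with _ | n
    · exact hu2 0
    · rw [show (-((n + 1 : ℕ) : ℤ) + 1) = -(n : ℤ) by push_cast; ring, hd]
  refine ⟨x, hu 0, (hu2 0).symm, fun k => ?_⟩
  rcases lt_or_ge 0 k with hk | hk
  · obtain ⟨n, rfl⟩ : ∃ n : ℕ, k = n + 1 := ⟨(k - 1).toNat, by omega⟩
    have h1 : (u (n + 1)).2 = q (n + 1) * (u n).2 - (u n).1 := rfl
    rw [hu2 (n + 1), hu2 n, ← hu n] at h1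
    push_cast at h1
    rw [h1, add_sub_cancel_right]
    ring
  · obtain ⟨n, rfl⟩ : ∃ n : ℕ, k = -n := ⟨(-k).toNat, by omega⟩
    have h1 : (d (n + 1)).1 = q (-n) * (d n).1 - (d n).2 := rfl
    rw [← hd (n + 1), ← hd n, hd2 n] at h1
    rw [show -(n : ℤ) - 1 = -((n + 1 : ℕ) : ℤ) by push_cast; ring, h1]
    ring

/-- Above the diagonal, the unimodular rule computes each entry from entries nearer the diagonal,
dividing by one that positivity makes nonzero; antisymmetry gives the rest. -/
theorem IsInfiniteFrieze.ext_of_quiddity {t t' : ℤ → ℤ → ℤ} (ht : IsInfiniteFrieze t)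
    (ht' : IsInfiniteFrieze t') (h : ∀ i, t (i - 1) (i + 1) = t' (i - 1) (i + 1)) : t = t' := by
  have key : ∀ (n : ℕ) (i : ℤ), t i (i + n) = t' i (i + n) := by
    intro n
    induction n using Nat.strong_induction_on with
    | _ n ih =>
    intro i
    match n, ih with
    | 0, _ => simp [ht.diag, ht'.diag]
    | 1, _ => simpa [ht.one] using (ht'.one i).symm
    | 2, _ => simpa [add_assoc] using h (i + 1)
    | n + 3, ih =>
      have e1 := ht.unimodular i (i + (n + 2 : ℕ))
      have e2 := ht'.unimodular i (i + (n + 2 : ℕ))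
      have h1 := ih (n + 2) (by omega) i
      have h2 := ih (n + 2) (by omega) (i + 1)
      have h3 := ih (n + 1) (by omega) (i + 1)
      have hpos := ht'.pos (i + 1) (i + 1 + (n + 1 : ℕ)) (by push_cast; omega)
      rw [show i + 1 + ((n + 2 : ℕ) : ℤ) = i + (n + 2 : ℕ) + 1 by ring] at h2
      rw [show i + 1 + ((n + 1 : ℕ) : ℤ) = i + (n + 2 : ℕ) by push_cast; ring] at h3 hpos
      rw [show i + ((n + 3 : ℕ) : ℤ) = i + (n + 2 : ℕ) + 1 by push_cast; ring]
      rw [h1, h2, h3] at e1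
      exact mul_right_cancel₀ (show t' (i + 1) (i + (n + 2 : ℕ)) ≠ 0 by omega) (by linarith)
  funext i j
  rcases le_total i j with hij | hij
  · obtain ⟨n, rfl⟩ := Int.le.dest hij
    exact key n i
  · obtain ⟨n, rfl⟩ := Int.le.dest hij
    rw [ht.antisymm, ht'.antisymm, key n j]

variable {M₂ : Set ℤ} {T : Set (Sym2 (MarkedPoint M₂))}

theorem exists_isPhi (hT : IsTriangulation T) (hadm : IsAdmissible T) :
    ∃ t, IsPhi T t ∧ ∀ i j, i < j → (t i j = 1 ↔ LowerAdj T i j) := by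
  let q : ℤ → ℤ := fun k => (trianglesAt T (.lower k)).ncard
  obtain ⟨x, x0, x1, hx⟩ := exists_recurrence q 1 0
  obtain ⟨y, y0, y1, hy⟩ := exists_recurrence q 0 1
  have hsucc : ∀ k, x k * y (k + 1) - y k * x (k + 1) = x (k - 1) * y k - y (k - 1) * x k := by
    intro k
    linear_combination x k * hy k - y k * hx k
  -- The discrete Wronskian of two solutions is constant.
  have hW : ∀ k, x k * y (k + 1) - y k * x (k + 1) = 1 := by
    intro k
    induction k with
    | zero => simp [x0, x1, y0, y1]
    | succ n ih => rw [hsucc, add_sub_cancel_right, ih]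
    | pred n ih => rw [hsucc] at ih; rw [sub_add_cancel, ih]
  have hf : ∀ i k, (x i * y (k + 1) - y i * x (k + 1)) + (x i * y (k - 1) - y i * x (k - 1)) =
      (trianglesAt T (.lower k)).ncard * (x i * y k - y i * x k) := by
    intro i k
    linear_combination x i * hy k - y i * hx k
  have hone : ∀ i j, i < j → LowerAdj T i j → x i * y j - y i * x j = 1 := fun i j hij h =>
    eq_one_of_lowerAdj (f := fun k => x i * y k - y i * x k) hT hadm (hf i) hij h (by ring) (hW i)
  have htwo : ∀ i j, i < j → ¬ LowerAdj T i j → 2 ≤ x i * y j - y i * x j := fun i j hij h =>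
    two_le_of_not_lowerAdj (f := fun k => x i * y k - y i * x k) hT hadm (hf i) hij h (by ring)
      (hW i)
  refine ⟨fun i j => x i * y j - y i * x j, ⟨⟨?_, ?_, hW, ?_, ?_⟩, fun i => ⟨?_, ?_⟩⟩, ?_⟩
  · intro i; ring
  · intro i j hij
    by_cases h : LowerAdj T i j
    · exact (hone i j hij h).ge
    · exact one_le_two.trans (htwo i j hij h)
  · intro i j; ring
  · intro i j
    -- Plücker relation for 2 × 2 determinants: the left side is the product of the Wronskians at
    -- `i` and `j`.
    linear_combination (x j * y (j + 1) - y j * x (j + 1)) * hW i + hW j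
  · exact (finite_trianglesAt_and_ncard hT hadm i).1
  · have h1 := hW (i - 1)
    rw [sub_add_cancel] at h1
    have h2 := hf (i - 1) i
    change x (i - 1) * y (i + 1) - y (i - 1) * x (i + 1) = _
    linear_combination h2 + ((trianglesAt T (.lower i)).ncard : ℤ) * h1
  · intro i j hij
    refine ⟨fun h => ?_, hone i j hij⟩
    by_contra hn
    have := htwo i j hij hn
    simp only at h
    omega

end Frieze

end InfiniteStrip

open InfiniteStrip in
/-- The first conjunct says that `Φ(T)` is well defined. -/
theorem corollary2p9 (M₂ : Set ℤ) (T : Set (Sym2 (MarkedPoint M₂)))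
    (hT : IsTriangulation T) (hadm : IsAdmissible T)
    (hspecial : ∀ u : M₂, ¬ IsSpecial T (MarkedPoint.upper u)) :
    (∃! t : ℤ → ℤ → ℤ, IsPhi T t) ∧
      ∀ t : ℤ → ℤ → ℤ, IsPhi T t → ∀ i j : ℤ, i ≤ j →
        (t i j = 1 ↔ j = i + 1 ∨ s(MarkedPoint.lower i, MarkedPoint.lower j) ∈ T) := by
  obtain ⟨t, ht, hadj⟩ := exists_isPhi hT hadm
  have huniq : ∀ t', IsPhi T t' → t' = t := fun t' ht' =>
    ht'.1.ext_of_quiddity ht.1 fun i => (ht'.2 i).2.trans (ht.2 i).2.symm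
  refine ⟨⟨t, ht, huniq⟩, fun t' ht' i j hij => ?_⟩
  obtain rfl := huniq t' ht'
  rcases hij.eq_or_lt with rfl | hij
  · rw [ht'.1.diag]
    refine iff_of_false zero_ne_one ?_
    rintro (h | h)
    · omega
    · exact (adj_of_mem hT h).1 rfl
  · rw [hadj i j hij, lowerAdj_iff hij]
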